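/- Write cells of $\mathbb{Z}^2$ as $(i,j)$, with $i$ the row (numbered downwards) and $j$ the column (numbered from left to right). A standard Young tableau of a finite shape $S\subseteq\mathbb{Z}^2$ is an injective map $f:S\to\{1,\dots,|S|\}$ such that $f(i,j)<f(i,j+1)$ whenever $(i,j),(i,j+1)\in S$, and $f(i,j)<f(i+1,j)$ whenever $(i,j),(i+1,j)\in S$. For a finite non-empty $P\subseteq\mathbb{Z}^2$, let $a$ and $b$ be the left-most cells of its top row and of its bottom row, respectively, and for integers $w\ge 0$ and $m\ge 1$ put $$Sh^w(P,m)=\bigcup_{i=0}^{m-1}\bigl(i\,(b-a+(1,w))+P\bigr).$$ For positive integers $n,k$ let $T(n,k)$ be the number of standard Young tableaux of shape $Sh^1(R,n)$, where $R=\{(1,j):1\le j\le k\}$ is a single row of $k$ cells; thus $Sh^1(R,n)$ consists of $n$ rows of $k$ cells, each shifted one column to the right of the row above it. Then $$T(n,4)=6\,T(n-1,4)-T(n-2,4)\qquad\text{for all } n\ge 3,$$ $$T(n,5)=24\,T(n-1,5)-40\,T(n-2,5)-8\,T(n-3,5)\qquad\text{for all } n\ge 4.$$ -/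

import Mathlib

namespace PeriodicSYT

/-- Cells are elements `(i, j)` of `ℤ × ℤ`, row `i` and column `j`, in English notation
(rows are numbered downwards, columns from left to right).
A partial tableau of shape `S`: an injective filling with positive integers that increases along
horizontally adjacent cells and down vertically adjacent cells. -/
structure IsPartialTableau (S : Finset (ℤ × ℤ)) (f : S → ℕ) : Prop where
  pos : ∀ v, 0 < f v
  injective : Function.Injective f
  row_lt : ∀ (i j : ℤ) (h : (i, j) ∈ S) (h' : (i, j + 1) ∈ S), f ⟨(i, j), h⟩ < f ⟨(i, j + 1), h'⟩
  col_lt : ∀ (i j : ℤ) (h : (i, j) ∈ S) (h' : (i + 1, j) ∈ S), f ⟨(i, j), h⟩ < f ⟨(i + 1, j), h'⟩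

/-- The set of standard Young tableaux of shape `S`: the partial tableaux of shape `S` all of whose
entries lie in `{1, …, |S|}`. -/
def SYT (S : Finset (ℤ × ℤ)) : Set (S → ℕ) :=
  {f | IsPartialTableau S f ∧ ∀ v, f v ∈ Finset.Icc 1 S.card}

/-- A shape has finitely many standard Young tableaux. -/
theorem SYT_finite (S : Finset (ℤ × ℤ)) : (SYT S).Finite :=
  (Set.Finite.pi' fun _ : S => (Finset.Icc 1 S.card).finite_toSet).subset fun _ hf v => hf.2 v

/-- The index of the top row of a (non-empty) shape. -/
noncomputable def topRow (P : Finset (ℤ × ℤ)) : ℤ := sInf {i | ∃ j, (i, j) ∈ P}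

/-- The index of the bottom row of a (non-empty) shape. -/
noncomputable def bottomRow (P : Finset (ℤ × ℤ)) : ℤ := sSup {i | ∃ j, (i, j) ∈ P}

/-- The left-most cell in row `i` of a shape (for a row that contains a cell). -/
noncomputable def leftmostCell (P : Finset (ℤ × ℤ)) (i : ℤ) : ℤ × ℤ := (i, sInf {j | (i, j) ∈ P})

/-- The translation `b - a + (1, w)` from one copy of the period to the next, where `a` and `b` are
the left-most cells in the top row and in the bottom row of `P`. -/
noncomputable def nabla (w : ℕ) (P : Finset (ℤ × ℤ)) : ℤ × ℤ :=
  leftmostCell P (bottomRow P) - leftmostCell P (topRow P) + (1, (w : ℤ))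

/-- The shape `Sh^w(P, m)`, the union of the `m` translates
`P, P + nabla w P, …, P + (m - 1) • nabla w P`. -/
noncomputable def Sh (w : ℕ) (P : Finset (ℤ × ℤ)) (m : ℕ) : Finset (ℤ × ℤ) :=
  (Finset.range m).biUnion fun i => P.image fun c => i • nabla w P + c

/-- The single row `{(1, j) : 1 ≤ j ≤ k}` of `k` cells. -/
noncomputable def singleRow (k : ℕ) : Finset (ℤ × ℤ) := (Finset.Icc 1 (k : ℤ)).image fun j => (1, j)

/-- The number of standard Young tableaux of shape `Sh^1(R, n)`, where `R` is a single row of `k`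
cells. -/
noncomputable def T (n k : ℕ) : ℕ := (SYT (Sh 1 (singleRow k) n)).ncard

end PeriodicSYT

namespace PeriodicSYT

open Finset

/-! Deleting the largest entry of a tableau erases a corner, so `ncard_SYT_eq_sum_corners` gives a
recursion over shapes. From full rows of length k it only reaches full rows followed by strictly
decreasing shorter rows, that is, by a subset of {1, …, k-1}. After every k deletions the number of
cells is again a multiple of k, hence so is the sum of the subset. This leaves ∅, {3,1} for k = 4
and ∅, {4,1}, {3,2}, {4,3,2,1} for k = 5. Expanding k deletions (`fullCount_four_nil` to
`fullCount_five_full`) yields a constant transfer matrix on these states, and Cayley–Hamilton for it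
gives the recurrences. -/

/-! ### Removing the largest entry -/

/-- The cells of `S` with no cell of `S` to the right of them or below them. -/
def corners (S : Finset (ℤ × ℤ)) : Finset (ℤ × ℤ) :=
  S.filter fun x => (x.1, x.2 + 1) ∉ S ∧ (x.1 + 1, x.2) ∉ S

/-- Extend a filling of `S.erase x` by the entry `|S|` in `x`. -/
def extendTop (S : Finset (ℤ × ℤ)) (x : ℤ × ℤ) (g : S.erase x → ℕ) (v : S) : ℕ :=
  if h : v.1 = x then S.card else g ⟨v.1, mem_erase.2 ⟨h, v.2⟩⟩

theorem extendTop_self {S : Finset (ℤ × ℤ)} {x : ℤ × ℤ} (g : S.erase x → ℕ) (hx : x ∈ S) :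
    extendTop S x g ⟨x, hx⟩ = S.card := by
  simp [extendTop]

theorem extendTop_of_ne {S : Finset (ℤ × ℤ)} {x : ℤ × ℤ} (g : S.erase x → ℕ) {v : ℤ × ℤ}
    (hv : v ∈ S) (h : v ≠ x) :
    extendTop S x g ⟨v, hv⟩ = g ⟨v, mem_erase.2 ⟨h, hv⟩⟩ := by
  simp [extendTop, h]

theorem extendTop_injective (S : Finset (ℤ × ℤ)) (x : ℤ × ℤ) :
    Function.Injective (extendTop S x) := by
  intro g g' h
  ext ⟨v, hv⟩
  have hv' := mem_erase.1 hv
  have := congrFun h ⟨v, hv'.2⟩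
  rwa [extendTop_of_ne _ _ hv'.1, extendTop_of_ne _ _ hv'.1] at this

theorem lt_card_of_mem_SYT_erase {S : Finset (ℤ × ℤ)} {x : ℤ × ℤ} (hx : x ∈ S)
    {g : S.erase x → ℕ} (hg : g ∈ SYT (S.erase x)) (v) : g v < S.card := by
  have h1 := (Finset.mem_Icc.1 (hg.2 v)).2
  have h2 := Finset.card_erase_lt_of_mem hx
  omega

theorem extendTop_mem_SYT {S : Finset (ℤ × ℤ)} {x : ℤ × ℤ} (hx : x ∈ corners S)
    {g : S.erase x → ℕ} (hg : g ∈ SYT (S.erase x)) : extendTop S x g ∈ SYT S := by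
  obtain ⟨hxS, hr, hd⟩ := mem_filter.1 hx
  have hlt := lt_card_of_mem_SYT_erase hxS hg
  have hpos : 0 < S.card := card_pos.2 ⟨x, hxS⟩
  refine ⟨⟨?_, ?_, ?_, ?_⟩, ?_⟩
  · rintro ⟨v, hv⟩
    by_cases h : v = x
    · subst h; rwa [extendTop_self]
    · rw [extendTop_of_ne _ _ h]; exact hg.1.pos _
  · rintro ⟨v, hv⟩ ⟨u, hu⟩ huv
    by_cases h : v = x <;> by_cases h' : u = x
    · subst h; subst h'; rfl
    · subst h; rw [extendTop_self, extendTop_of_ne _ _ h'] at huv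
      exact absurd huv (hlt _).ne'
    · subst h'; rw [extendTop_self, extendTop_of_ne _ _ h] at huv
      exact absurd huv (hlt _).ne
    · rw [extendTop_of_ne _ _ h, extendTop_of_ne _ _ h'] at huv
      simpa using hg.1.injective huv
  · intro i j h h'
    have hne : (i, j) ≠ x := by rintro rfl; exact hr h'
    rw [extendTop_of_ne _ _ hne]
    by_cases e : (i, j + 1) = x
    · subst e; rw [extendTop_self]; exact hlt _
    · rw [extendTop_of_ne _ _ e]; exact hg.1.row_lt _ _ _ _
  · intro i j h h'
    have hne : (i, j) ≠ x := by rintro rfl; exact hd h'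
    rw [extendTop_of_ne _ _ hne]
    by_cases e : (i + 1, j) = x
    · subst e; rw [extendTop_self]; exact hlt _
    · rw [extendTop_of_ne _ _ e]; exact hg.1.col_lt _ _ _ _
  · rintro ⟨v, hv⟩
    rw [Finset.mem_Icc]
    by_cases h : v = x
    · subst h; rw [extendTop_self]; omega
    · rw [extendTop_of_ne _ _ h]; exact ⟨hg.1.pos _, (hlt _).le⟩

theorem exists_extendTop_eq {S : Finset (ℤ × ℤ)} (hS : S.Nonempty) {f : S → ℕ} (hf : f ∈ SYT S) :
    ∃ x ∈ corners S, ∃ g ∈ SYT (S.erase x), extendTop S x g = f := by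
  -- By counting, an injective filling takes every value, so the entry |S| occurs.
  have himg : univ.image f = Finset.Icc 1 S.card := by
    apply Finset.eq_of_subset_of_card_le
    · intro y hy
      obtain ⟨v, -, rfl⟩ := mem_image.1 hy
      exact hf.2 v
    · rw [card_image_of_injective _ hf.1.injective]; simp
  have hpos : 0 < S.card := card_pos.2 hS
  have hmem : S.card ∈ univ.image f := by rw [himg, Finset.mem_Icc]; omega
  obtain ⟨⟨x, hx⟩, -, hfx⟩ := mem_image.1 hmem
  have hle : ∀ v, f v ≤ S.card := fun v => (Finset.mem_Icc.1 (hf.2 v)).2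
  refine ⟨x, mem_filter.2 ⟨hx, fun h => ?_, fun h => ?_⟩,
    fun v => f ⟨v.1, mem_of_mem_erase v.2⟩, ⟨⟨?_, ?_, ?_, ?_⟩, ?_⟩, ?_⟩
  · exact absurd (hf.1.row_lt x.1 x.2 hx h) (by rw [hfx]; exact (hle _).not_gt)
  · exact absurd (hf.1.col_lt x.1 x.2 hx h) (by rw [hfx]; exact (hle _).not_gt)
  · exact fun v => hf.1.pos _
  · intro u v huv
    have := hf.1.injective huv
    ext1
    simpa using this
  · exact fun i j h h' => hf.1.row_lt i j _ _
  · exact fun i j h h' => hf.1.col_lt i j _ _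
  · intro v
    have h1 := hf.2 ⟨v.1, mem_of_mem_erase v.2⟩
    have h2 : f ⟨v.1, mem_of_mem_erase v.2⟩ ≠ S.card := by
      rw [← hfx]
      intro h
      exact ne_of_mem_erase v.2 (by simpa using hf.1.injective h)
    rw [Finset.mem_Icc] at h1 ⊢
    rw [card_erase_of_mem hx]
    dsimp only
    omega
  · ext ⟨v, hv⟩
    by_cases h : v = x
    · subst h; rw [extendTop_self, hfx]
    · rw [extendTop_of_ne _ _ h]

/-- Removing the largest entry: standard tableaux of `S` correspond to standard tableaux of the
shapes obtained from `S` by erasing a corner. -/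
theorem ncard_SYT_eq_sum_corners {S : Finset (ℤ × ℤ)} (hS : S.Nonempty) :
    (SYT S).ncard = ∑ x ∈ corners S, (SYT (S.erase x)).ncard := by
  have hU : SYT S = ⋃ x : corners S, extendTop S x '' SYT (S.erase x) := by
    ext f
    simp only [Set.mem_iUnion, Set.mem_image]
    constructor
    · intro hf
      obtain ⟨x, hx, g, hg, h⟩ := exists_extendTop_eq hS hf
      exact ⟨⟨x, hx⟩, g, hg, h⟩
    · rintro ⟨⟨x, hx⟩, g, hg, rfl⟩
      exact extendTop_mem_SYT hx hg
  rw [hU, Set.ncard_iUnion_of_finite, finsum_eq_sum_of_fintype, ← Finset.sum_coe_sort (corners S)]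
  · exact Finset.sum_congr rfl fun x _ => Set.ncard_image_of_injective _ (extendTop_injective _ _)
  · exact fun x => (SYT_finite _).image _
  · rintro ⟨x, hx⟩ ⟨y, hy⟩ hxy
    refine Set.disjoint_left.2 ?_
    rintro _ ⟨g, hg, rfl⟩ ⟨g', hg', h⟩
    have hxS := (mem_filter.1 hx).1
    have hne : x ≠ y := fun e => hxy (Subtype.ext e)
    have := congrFun h ⟨x, hxS⟩
    rw [extendTop_self, extendTop_of_ne _ _ hne] at this
    exact (lt_card_of_mem_SYT_erase (mem_filter.1 hy).1 hg' _).ne this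

/-! ### Sheared shapes and their corners -/

/-- The left-justified shape with row lengths `l`, sheared so that every row is shifted one column
to the right of the row above it. -/
def staircase (l : List ℕ) : Finset (ℤ × ℤ) :=
  (range l.length).biUnion fun i =>
    (range (l.getD i 0)).image fun p : ℕ => ((i : ℤ) + 1, (i : ℤ) + 1 + p)

theorem mem_staircase {l : List ℕ} {x : ℤ × ℤ} :
    x ∈ staircase l ↔ ∃ i p : ℕ, p < l.getD i 0 ∧ x = ((i : ℤ) + 1, (i : ℤ) + 1 + p) := by
  simp only [staircase, mem_biUnion, mem_image, mem_range]
  constructor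
  · rintro ⟨i, -, p, hp, rfl⟩
    exact ⟨i, p, hp, rfl⟩
  · rintro ⟨i, p, hp, rfl⟩
    refine ⟨i, ?_, p, hp, rfl⟩
    by_contra h
    rw [List.getD_eq_default _ _ (not_lt.1 h)] at hp
    omega

theorem mk_mem_staircase {l : List ℕ} {i : ℕ} {z : ℤ} :
    ((i : ℤ) + 1, z) ∈ staircase l ↔ (i : ℤ) + 1 ≤ z ∧ z < i + 1 + l.getD i 0 := by
  rw [mem_staircase]
  constructor
  · rintro ⟨i', p, hp, h⟩
    simp only [Prod.mk.injEq] at h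
    obtain rfl : i = i' := by omega
    omega
  · rintro ⟨h1, h2⟩
    exact ⟨i, (z - (i + 1)).toNat, by omega, by simp only [Prod.mk.injEq, true_and]; omega⟩

/-- The number of standard tableaux of a sheared shape with given row lengths. -/
noncomputable def count (l : List ℕ) : ℕ := (SYT (staircase l)).ncard

/-- The last cell of row `i` has no cell below it. -/
abbrev IsRemovable (l : List ℕ) (i : ℕ) : Prop :=
  l.getD (i + 1) 0 + 1 < l.getD i 0 ∨ l.getD i 0 = 1

theorem IsRemovable.pos {l : List ℕ} {i : ℕ} (h : IsRemovable l i) : 0 < l.getD i 0 := by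
  unfold IsRemovable at h; omega

/-- Each row starts one column to the right of the row above, so a one-cell row never has a cell
below it; this is the second case of `IsRemovable`. -/
theorem corners_staircase (l : List ℕ) :
    corners (staircase l) = ((range l.length).filter (IsRemovable l)).image
      fun i : ℕ => ((i : ℤ) + 1, (i : ℤ) + l.getD i 0) := by
  ext x
  simp only [corners, mem_filter, mem_image, mem_range]
  constructor
  · rintro ⟨hx, hr, hd⟩
    obtain ⟨i, p, hp, rfl⟩ := mem_staircase.1 hx
    rw [mk_mem_staircase] at hr
    have := mk_mem_staircase (l := l) (i := i + 1) (z := (i : ℤ) + 1 + p)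
    push_cast at this
    rw [this] at hd
    have hi : i < l.length := by
      by_contra h
      rw [List.getD_eq_default _ _ (not_lt.1 h)] at hp
      omega
    refine ⟨i, ⟨hi, ?_⟩, ?_⟩
    · unfold IsRemovable; omega
    · simp only [Prod.mk.injEq, true_and]; omega
  · rintro ⟨i, ⟨hi, h⟩, rfl⟩
    have hp := h.pos
    have := mk_mem_staircase (l := l) (i := i + 1) (z := (i : ℤ) + l.getD i 0)
    push_cast at this
    rw [mk_mem_staircase, mk_mem_staircase, this]
    unfold IsRemovable at h
    omega

theorem getD_set (l : List ℕ) (i j a : ℕ) (hi : i < l.length) :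
    (l.set i a).getD j 0 = if i = j then a else l.getD j 0 := by
  simp only [List.getD_eq_getElem?_getD, List.getElem?_set]
  split_ifs <;> simp_all

theorem staircase_erase {l : List ℕ} {i : ℕ} (h : 0 < l.getD i 0) :
    (staircase l).erase ((i : ℤ) + 1, (i : ℤ) + l.getD i 0) =
      staircase (l.set i (l.getD i 0 - 1)) := by
  have hi : i < l.length := by
    by_contra h'
    rw [List.getD_eq_default _ _ (not_lt.1 h')] at h
    omega
  ext x
  rw [mem_erase, mem_staircase, mem_staircase]
  constructor
  · rintro ⟨hne, j, p, hp, rfl⟩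
    refine ⟨j, p, ?_, rfl⟩
    rw [getD_set _ _ _ _ hi]
    split_ifs with e
    · subst e
      simp only [ne_eq, Prod.mk.injEq, true_and] at hne
      omega
    · exact hp
  · rintro ⟨j, p, hp, rfl⟩
    rw [getD_set _ _ _ _ hi] at hp
    split_ifs at hp with e
    · subst e
      refine ⟨?_, i, p, by omega, rfl⟩
      simp only [ne_eq, Prod.mk.injEq, true_and]
      omega
    · refine ⟨?_, j, p, hp, rfl⟩
      simp only [ne_eq, Prod.mk.injEq]
      omega

/-- The positive row rules out the empty shape, which has one tableau but no corner. -/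
theorem count_eq_sum {l : List ℕ} {i : ℕ} (h : 0 < l.getD i 0) :
    count l = ∑ i ∈ range l.length,
      if IsRemovable l i then count (l.set i (l.getD i 0 - 1)) else 0 := by
  have hne : (staircase l).Nonempty := ⟨_, mem_staircase.2 ⟨i, 0, h, rfl⟩⟩
  rw [count, ncard_SYT_eq_sum_corners hne, corners_staircase, sum_image, sum_filter]
  · refine sum_congr rfl fun i _ => ?_
    split_ifs with h
    · rw [staircase_erase h.pos, count]
    · rfl
  · intro i _ j _ hij
    simp only [Prod.mk.injEq] at hij
    omega

theorem count_congr {l l' : List ℕ} (h : ∀ i, l.getD i 0 = l'.getD i 0) : count l = count l' := by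
  have : staircase l = staircase l' := by
    ext x
    simp only [mem_staircase, h]
  rw [count, this, count]

theorem count_append_zero (l : List ℕ) : count (l ++ [0]) = count l := by
  refine count_congr fun i => ?_
  rcases lt_or_ge i l.length with h | h
  · rw [List.getD_append _ _ _ _ h]
  · rw [List.getD_append_right _ _ _ _ h, List.getD_eq_default _ _ h]
    cases i - l.length <;> simp

theorem getD_replicate_append_add (n k : ℕ) (l : List ℕ) (i : ℕ) :
    (List.replicate n k ++ l).getD (n + i) 0 = l.getD i 0 := by
  rw [List.getD_append_right _ _ _ _ (by simp)]
  simp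

theorem getD_replicate_append {n k i : ℕ} (l : List ℕ) (h : i < n) :
    (List.replicate n k ++ l).getD i 0 = k := by
  rw [List.getD_append _ _ _ _ (by simpa)]
  simp [List.getD_eq_getElem?_getD, h]

theorem sum_range_append (n k : ℕ) (l : List ℕ) :
    (∑ i ∈ range l.length, if IsRemovable (List.replicate n k ++ l) (n + i) then
        count ((List.replicate n k ++ l).set (n + i)
          ((List.replicate n k ++ l).getD (n + i) 0 - 1)) else 0) =
      ∑ i ∈ range l.length, if IsRemovable l i then
        count (List.replicate n k ++ l.set i (l.getD i 0 - 1)) else 0 := by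
  refine sum_congr rfl fun i _ => ?_
  simp only [IsRemovable, add_assoc, getD_replicate_append_add]
  rw [List.set_append_right _ _ (by simp)]
  simp

/-- Only the last full row can lose a cell: for k ≥ 2, the last cell of a full row lies above a cell
of the next full row. -/
theorem count_replicate_append {n k : ℕ} (hk : 2 ≤ k) (l : List ℕ) :
    count (List.replicate (n + 1) k ++ l) =
      (if l.getD 0 0 + 1 < k then count (List.replicate n k ++ (k - 1) :: l) else 0) +
      ∑ i ∈ range l.length, if IsRemovable l i then
        count (List.replicate (n + 1) k ++ l.set i (l.getD i 0 - 1)) else 0 := by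
  have hpos : 0 < (List.replicate (n + 1) k ++ l).getD 0 0 := by
    rw [getD_replicate_append l (by omega)]; omega
  rw [count_eq_sum hpos, List.length_append, List.length_replicate, sum_range_add,
    sum_range_append, sum_range_succ, sum_eq_zero, zero_add]
  · congr 1
    have h0 := getD_replicate_append_add (n + 1) k l 0
    rw [add_zero] at h0
    simp only [IsRemovable, h0, getD_replicate_append l (Nat.lt_succ_self n)]
    have hk1 : k ≠ 1 := by omega
    simp only [hk1, or_false]
    congr 2
    rw [List.replicate_succ', List.append_assoc, List.set_append_right _ _ (by simp)]
    simp
  · intro i hi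
    rw [mem_range] at hi
    rw [if_neg]
    simp only [IsRemovable]
    rw [getD_replicate_append l (by omega), getD_replicate_append l (by omega)]
    omega

/-! ### Recursion on the partial rows -/

/-- The number of standard tableaux with `n - 2` rows of length `k` followed by rows of lengths
`l`; the value is zero for `n < 2`. -/
noncomputable def fullCount (k : ℕ) : ℕ → List ℕ → ℕ
  | n + 2, l => count (List.replicate n k ++ l)
  | _, _ => 0

theorem fullCount_append_zero (k n : ℕ) (l : List ℕ) :
    fullCount k n (l ++ [0]) = fullCount k n l := by
  match n with
  | 0 => rfl
  | 1 => rfl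
  | n + 2 => rw [fullCount, fullCount, ← List.append_assoc, count_append_zero]

theorem fullCount_nil (k n : ℕ) (hk : 2 ≤ k) :
    fullCount k (n + 3) [] = fullCount k (n + 2) [k - 1] := by
  rw [fullCount, fullCount, count_replicate_append hk]
  rw [if_pos (by simp only [List.getD_nil]; omega), List.length_nil, range_zero, sum_empty, add_zero]

/-- Shortening a full row turns it into a partial row, so the index drops by one. At index 2 no full
row is left, and the zero value at index 1 kills that term. -/
theorem fullCount_cons {k a : ℕ} (n : ℕ) (hk : 2 ≤ k) (ha : 0 < a) (l : List ℕ) :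
    fullCount k (n + 1) (a :: l) =
      (if a + 1 < k then fullCount k n ((k - 1) :: a :: l) else 0) +
      ∑ i ∈ range (l.length + 1), if IsRemovable (a :: l) i then
        fullCount k (n + 1) ((a :: l).set i ((a :: l).getD i 0 - 1)) else 0 := by
  match n with
  | 0 => simp [fullCount]
  | 1 =>
    simp only [fullCount, List.replicate_zero, List.nil_append, ite_self, zero_add]
    exact count_eq_sum (i := 0) (by simpa)
  | n + 2 =>
    simp only [fullCount]
    exact count_replicate_append hk _

/-! ### Identifying the periodic shape -/

theorem topRow_singleRow {k : ℕ} (hk : 0 < k) : topRow (singleRow k) = 1 := by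
  have : {i | ∃ j, (i, j) ∈ singleRow k} = {1} := by
    ext i
    simp only [singleRow, mem_image, Finset.mem_Icc, Prod.mk.injEq, Set.mem_ofPred_eq,
      Set.mem_singleton_iff]
    exact ⟨fun ⟨_, _, _, h, _⟩ => h.symm, fun h => ⟨1, 1, by omega, h.symm, rfl⟩⟩
  rw [topRow, this, csInf_singleton]

theorem bottomRow_singleRow {k : ℕ} (hk : 0 < k) : bottomRow (singleRow k) = 1 := by
  have : {i | ∃ j, (i, j) ∈ singleRow k} = {1} := by
    ext i
    simp only [singleRow, mem_image, Finset.mem_Icc, Prod.mk.injEq, Set.mem_ofPred_eq,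
      Set.mem_singleton_iff]
    exact ⟨fun ⟨_, _, _, h, _⟩ => h.symm, fun h => ⟨1, 1, by omega, h.symm, rfl⟩⟩
  rw [bottomRow, this, csSup_singleton]

theorem nabla_singleRow {k : ℕ} (hk : 0 < k) (w : ℕ) : nabla w (singleRow k) = (1, (w : ℤ)) := by
  rw [nabla, topRow_singleRow hk, bottomRow_singleRow hk, sub_self, zero_add]

theorem Sh_singleRow {k : ℕ} (hk : 0 < k) (n : ℕ) :
    Sh 1 (singleRow k) n = staircase (List.replicate n k) := by
  ext x
  rw [Sh, nabla_singleRow hk]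
  simp only [singleRow, mem_biUnion, mem_image, mem_range,
    Finset.mem_Icc, mem_staircase]
  constructor
  · rintro ⟨i, hi, _, ⟨j, hj, rfl⟩, rfl⟩
    refine ⟨i, (j - 1).toNat, ?_, ?_⟩
    · have := getD_replicate_append (k := k) [] hi
      rw [List.append_nil] at this
      omega
    · simp only [nsmul_eq_mul, Nat.cast_one, Prod.ext_iff, Prod.fst_add, Prod.snd_add,
        Prod.fst_mul, Prod.snd_mul, Prod.fst_natCast, Prod.snd_natCast, mul_one, true_and]
      omega
  · rintro ⟨i, p, hp, rfl⟩
    have hi : i < n := by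
      by_contra h
      rw [List.getD_eq_default _ _ (by simpa using h)] at hp
      omega
    have := getD_replicate_append (k := k) [] hi
    rw [List.append_nil] at this
    refine ⟨i, hi, (1, (p : ℤ) + 1), ⟨_, by omega, rfl⟩, ?_⟩
    simp only [nsmul_eq_mul, Nat.cast_one, Prod.ext_iff, Prod.fst_add, Prod.snd_add,
      Prod.fst_mul, Prod.snd_mul, Prod.fst_natCast, Prod.snd_natCast, mul_one, true_and]
    omega

theorem T_eq_fullCount {k : ℕ} (hk : 0 < k) (n : ℕ) : T n k = fullCount k (n + 2) [] := by
  rw [T, Sh_singleRow hk, fullCount, List.append_nil, count]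

/-! ### Transfer matrices for k = 4 and k = 5 -/

theorem fullCount_pair_zero (k n a : ℕ) : fullCount k n [a, 0] = fullCount k n [a] :=
  fullCount_append_zero k n [a]

theorem fullCount_triple_zero (k n a b : ℕ) : fullCount k n [a, b, 0] = fullCount k n [a, b] :=
  fullCount_append_zero k n [a, b]

theorem fullCount_quadruple_zero (k n a b c : ℕ) :
    fullCount k n [a, b, c, 0] = fullCount k n [a, b, c] :=
  fullCount_append_zero k n [a, b, c]

theorem fullCount_quintuple_zero (k n a b c d : ℕ) :
    fullCount k n [a, b, c, d, 0] = fullCount k n [a, b, c, d] :=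
  fullCount_append_zero k n [a, b, c, d]

theorem fullCount_singleton_zero (k n : ℕ) : fullCount k n [0] = fullCount k n [] :=
  fullCount_append_zero k n []

theorem fullCount_four_nil (m : ℕ) :
    fullCount 4 (m + 3) [] = fullCount 4 (m + 2) [] + 2 * fullCount 4 (m + 1) [3, 1] := by
  simp [fullCount_nil, fullCount_cons, sum_range_succ, IsRemovable, fullCount_singleton_zero,
    fullCount_pair_zero, fullCount_triple_zero]
  ring

theorem fullCount_four_pair (m : ℕ) :
    fullCount 4 (m + 2) [3, 1] = 2 * fullCount 4 (m + 2) [] + 5 * fullCount 4 (m + 1) [3, 1] := by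
  simp [fullCount_cons, sum_range_succ, IsRemovable, fullCount_singleton_zero,
    fullCount_pair_zero, fullCount_triple_zero, fullCount_quadruple_zero]
  ring

/-- One row of the transfer matrix: each shape on the right has 5m cells, five fewer than the left
side. -/
theorem fullCount_five_nil (m : ℕ) :
    fullCount 5 (m + 3) [] = fullCount 5 (m + 2) [] + 3 * fullCount 5 (m + 1) [4, 1] +
      2 * fullCount 5 (m + 1) [3, 2] := by
  simp [fullCount_nil, fullCount_cons, sum_range_succ, IsRemovable, fullCount_singleton_zero,
    fullCount_pair_zero, fullCount_triple_zero]
  ring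

theorem fullCount_five_outer (m : ℕ) :
    fullCount 5 (m + 2) [4, 1] = 3 * fullCount 5 (m + 2) [] + 11 * fullCount 5 (m + 1) [4, 1] +
      10 * fullCount 5 (m + 1) [3, 2] + 2 * fullCount 5 m [4, 3, 2, 1] := by
  simp [fullCount_cons, sum_range_succ, IsRemovable, fullCount_singleton_zero,
    fullCount_pair_zero, fullCount_triple_zero, fullCount_quadruple_zero]
  ring

theorem fullCount_five_inner (m : ℕ) :
    fullCount 5 (m + 2) [3, 2] = 2 * fullCount 5 (m + 2) [] + 10 * fullCount 5 (m + 1) [4, 1] +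
      11 * fullCount 5 (m + 1) [3, 2] + 3 * fullCount 5 m [4, 3, 2, 1] := by
  simp [fullCount_cons, sum_range_succ, IsRemovable, fullCount_singleton_zero,
    fullCount_pair_zero, fullCount_triple_zero, fullCount_quadruple_zero]
  ring

theorem fullCount_five_full (m : ℕ) :
    fullCount 5 (m + 1) [4, 3, 2, 1] = 2 * fullCount 5 (m + 1) [4, 1] +
      3 * fullCount 5 (m + 1) [3, 2] + fullCount 5 m [4, 3, 2, 1] := by
  simp [fullCount_cons, sum_range_succ, IsRemovable, fullCount_singleton_zero,
    fullCount_pair_zero, fullCount_triple_zero, fullCount_quadruple_zero,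
    fullCount_quintuple_zero]
  ring

/-- The matrix with rows (1,2), (2,5) has characteristic polynomial x² - 6x + 1. -/
theorem T_four_rec (m : ℕ) : T (m + 2) 4 + T m 4 = 6 * T (m + 1) 4 := by
  simp only [T_eq_fullCount (k := 4) (by norm_num)]
  have h1 := fullCount_four_nil m
  have h2 := fullCount_four_nil (m + 1)
  have h3 := fullCount_four_pair m
  simp only [add_assoc, Nat.reduceAdd] at *
  omega

/-- The 4×4 matrix is singular, with characteristic polynomial x(x³ - 24x² + 40x + 8). The factor x
is why the oldest term is `T (m + 1) 5` and not `T m 5`. -/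
theorem T_five_rec (m : ℕ) :
    T (m + 4) 5 + 40 * T (m + 2) 5 + 8 * T (m + 1) 5 = 24 * T (m + 3) 5 := by
  simp only [T_eq_fullCount (k := 5) (by norm_num)]
  have a0 := fullCount_five_nil m
  have a1 := fullCount_five_nil (m + 1)
  have a2 := fullCount_five_nil (m + 2)
  have a3 := fullCount_five_nil (m + 3)
  have b0 := fullCount_five_outer m
  have b1 := fullCount_five_outer (m + 1)
  have b2 := fullCount_five_outer (m + 2)
  have c0 := fullCount_five_inner m
  have c1 := fullCount_five_inner (m + 1)
  have c2 := fullCount_five_inner (m + 2)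
  have d0 := fullCount_five_full m
  have d1 := fullCount_five_full (m + 1)
  simp only [add_assoc, Nat.reduceAdd] at *
  -- Linear elimination of the three auxiliary sequences.
  omega

end PeriodicSYT

theorem corollary1 :
    (∀ n : ℕ, 3 ≤ n →
      (PeriodicSYT.T n 4 : ℤ) = 6 * PeriodicSYT.T (n - 1) 4 - PeriodicSYT.T (n - 2) 4) ∧
    (∀ n : ℕ, 4 ≤ n →
      (PeriodicSYT.T n 5 : ℤ) =
        24 * PeriodicSYT.T (n - 1) 5 - 40 * PeriodicSYT.T (n - 2) 5
          - 8 * PeriodicSYT.T (n - 3) 5) := by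
  constructor
  · intro n hn
    obtain ⟨m, rfl⟩ := Nat.exists_eq_add_of_le' (show 2 ≤ n by omega)
    have h := PeriodicSYT.T_four_rec m
    rw [show m + 2 - 1 = m + 1 by omega, show m + 2 - 2 = m by omega]
    omega
  · intro n hn
    obtain ⟨m, rfl⟩ := Nat.exists_eq_add_of_le' hn
    have h := PeriodicSYT.T_five_rec m
    rw [show m + 4 - 1 = m + 3 by omega, show m + 4 - 2 = m + 2 by omega,
      show m + 4 - 3 = m + 1 by omega]
    omega
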